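/- **Conventions.** For a quandle $X$, an $X$-coloring of an oriented knot diagram $D$ in the plane assigns to each arc of $D$ an element of $X$ so that, at each crossing whose over-arc has color $y$, if the under-arc to the right of the over-arc has color $x$, then the under-arc to its left has color $x*y$. Each Reidemeister move and each planar isotopy from a diagram $D_1$ to a diagram $D_2$ carries each $X$-coloring of $D_1$ to the unique $X$-coloring of $D_2$ that agrees with it away from the move. Two $X$-colorings of a diagram are *R-equivalent* if a finite sequence of Reidemeister moves and planar isotopies carries one to the other. $\mathrm{Rot}\,\mathbb{E}^2$ is the quandle $\mathbb{C}\times \mathrm{U}(1)$ with $(z,e^{\theta\sqrt{-1}})*(w,e^{\eta\sqrt{-1}})=\bigl((z-w)e^{\eta\sqrt{-1}}+w,\;e^{\theta\sqrt{-1}}\bigr)$. For $1\le k\le m-1$, a *regular polygon of type $(m,k)$* has vertices $w_j=c+\rho\, e^{2\pi\sqrt{-1}\,kj/m}$ ($j\in\mathbb{Z}/m$), where $c,\rho\in\mathbb{C}$ and $\rho\neq 0$; its side length is $|w_1-w_0|$. Let $Q$ be a regular polygon of type $(n,l)$ with vertices $v_0,\dots,v_{n-1}$, and let $P_0$ be one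 of type $(m,k)$ with vertices $w_{0,j}$ such that $w_{0,0}=v_0$ and $w_{0,1}=v_1$. Let $\theta=\left(\frac{m-2k}{m}-\frac{n-2l}{n}\right)\pi$ and, for $1\le i\le n-1$, let $P_i$, with vertices $w_{i,j}$, be obtained from $P_{i-1}$ by the rotation about $v_i$ by the angle $\theta$, so that $w_{i,j}=(w_{i-1,j}-v_i)e^{\theta\sqrt{-1}}+v_i$. This is the *$(m,k;n,l)$-trochoid around $Q$ starting at $P_0$*. Let $p,q$ be coprime integers with $|p|,|q|\ge 2$. If $pq>0$, let $D(p,q)$ be the diagram of the $(p,q)$-torus knot that is the closure of the following braid on $|p|$ strands, drawn upwards and closed up on the right. It consists of $|q|$ equal blocks, indexed by $i\in\mathbb{Z}/|q|$ from bottom to top; in each block the leftmost strand passes over all the others to the rightmost place. If $pq<0$, let $D(p,q)$ be the image of $D(|p|,|q|)$ under a reflection of the plane, with reversed orientation. Let $a_{i,j}$ ($0\le j\le |p|-1$) be the arc that in $D(|p|,|q|)$ is in the $j$-th place from the left (counting from $0$) just below block $i$; its image under the reflection is also denoted by $a_{i,j}$. Thus $a_{i,0}=a_{i+1,|p|-1}$,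 and at each crossing $a_{i,0}$ passes over, with $a_{i,j}$ on its right and $a_{i+1,j-1}$ on its left ($1\le j\le |p|-1$). The *coloring derived from* a $(|p|,k;|q|,l)$-trochoid as above (with $m=|p|$, $n=|q|$) is the (non-trivial) $\mathrm{Rot}\,\mathbb{E}^2$-coloring $$a_{i,j}\longmapsto \bigl(w_{i,\,i+j+1},\,e^{\theta\sqrt{-1}}\bigr)\qquad (0\le i\le |q|-1,\ 0\le j\le |p|-1)$$ of $D(p,q)$, where the second index of $w$ is taken modulo $|p|$. **Theorem 5.2.** Let $p,q$ be coprime integers with $|p|,|q|\ge2$, and let $1\le k\le|p|-1$ and $1\le l\le |q|-1$. Let $\mathscr{C}$ and $\mathscr{C}'$ be the $\mathrm{Rot}\,\mathbb{E}^2$-colorings of $D(p,q)$ derived from $(|p|,k;|q|,l)$-trochoids around regular polygons $Q$ and $Q'$ respectively. If $\mathscr{C}'$ is R-equivalent to $\mathscr{C}$, then $Q$ and $Q'$ have the same side length. -/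

import Mathlib

open Complex

/-! ## Oriented knot diagrams in the plane

A diagram is recorded by its signed Gauss word, read along the oriented knot from a base point that
lies on an edge bordering the unbounded region, together with the side of that edge on which the
unbounded region lies. A word is realised by a diagram on the sphere exactly when the surface
obtained by gluing a disc to each of its boundary walks has Euler characteristic two; the realisation
is then unique up to orientation preserving homeomorphism, and the marked region puts it in the
plane. -/

/-- A crossing: a name and a sign (names are pairs of naturals; any infinite supply would do). -/
@[ext] structure Crossing where
  name : ℕ × ℕ
  positive : Bool
deriving DecidableEq

/-- A passage of the knot through a crossing, along the upper or along the lower strand. -/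
@[ext] structure Pass where
  crossing : Crossing
  isOver : Bool
deriving DecidableEq

/-- The two sides of an oriented edge. -/
inductive Side
  | left
  | right
deriving DecidableEq

/-- `Corner w (i, s) (j, t)`: side `s` of edge `i` and side `t` of edge `j` meet along a corner of a
crossing. Edge `i` is the piece of the knot just before the letter of index `i` of `w`; so the letter
of index `i` leads from edge `i` to edge `i + 1`, and the word being cyclic, edge `w.length` is again
the base edge `0` (larger indices are also names for it, so that no junk edges appear).
At a positive crossing the lower strand goes from the right to the left of the upper strand, at a
negative one from the left to the right. The constructor names describe the four corners as seen by the
upper strand. -/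
inductive Corner (w : List Pass) : ℕ × Side → ℕ × Side → Prop
  | base (i : ℕ) (s : Side) (hi : w.length ≤ i) : Corner w (i, s) (0, s)
  | posFrontLeft (a : ℕ × ℕ) (i j : ℕ) (hi : w[i]? = some ⟨⟨a, true⟩, true⟩)
      (hj : w[j]? = some ⟨⟨a, true⟩, false⟩) : Corner w (i + 1, .left) (j + 1, .right)
  | posBackLeft (a : ℕ × ℕ) (i j : ℕ) (hi : w[i]? = some ⟨⟨a, true⟩, true⟩)
      (hj : w[j]? = some ⟨⟨a, true⟩, false⟩) : Corner w (i, .left) (j + 1, .left)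
  | posBackRight (a : ℕ × ℕ) (i j : ℕ) (hi : w[i]? = some ⟨⟨a, true⟩, true⟩)
      (hj : w[j]? = some ⟨⟨a, true⟩, false⟩) : Corner w (i, .right) (j, .left)
  | posFrontRight (a : ℕ × ℕ) (i j : ℕ) (hi : w[i]? = some ⟨⟨a, true⟩, true⟩)
      (hj : w[j]? = some ⟨⟨a, true⟩, false⟩) : Corner w (i + 1, .right) (j, .right)
  | negFrontLeft (a : ℕ × ℕ) (i j : ℕ) (hi : w[i]? = some ⟨⟨a, false⟩, true⟩)
      (hj : w[j]? = some ⟨⟨a, false⟩, false⟩) : Corner w (i + 1, .left) (j, .left)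
  | negBackLeft (a : ℕ × ℕ) (i j : ℕ) (hi : w[i]? = some ⟨⟨a, false⟩, true⟩)
      (hj : w[j]? = some ⟨⟨a, false⟩, false⟩) : Corner w (i, .left) (j, .right)
  | negBackRight (a : ℕ × ℕ) (i j : ℕ) (hi : w[i]? = some ⟨⟨a, false⟩, true⟩)
      (hj : w[j]? = some ⟨⟨a, false⟩, false⟩) : Corner w (i, .right) (j + 1, .right)
  | negFrontRight (a : ℕ × ℕ) (i j : ℕ) (hi : w[i]? = some ⟨⟨a, false⟩, true⟩)
      (hj : w[j]? = some ⟨⟨a, false⟩, false⟩) : Corner w (i + 1, .right) (j + 1, .left)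

/-- The complementary regions: classes of sides of edges, under the relation generated by corners. -/
def Region (w : List Pass) : Type := Quot (Corner w)

/-- The region lying on a given side of a given edge. -/
def regionAt (w : List Pass) (e : ℕ × Side) : Region w := Quot.mk _ e

/-- `w` is the signed Gauss word of an oriented knot diagram on the sphere: each crossing that occurs
is passed exactly once above and once below, and, `w.length / 2` being the number of crossings, there
are two more regions than crossings (Euler's formula for a connected 4-valent graph). -/
structure IsKnotWord (w : List Pass) : Prop where
  nodup : w.Nodup
  over_iff_under : ∀ c : Crossing, (⟨c, true⟩ : Pass) ∈ w ↔ (⟨c, false⟩ : Pass) ∈ w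
  planar : 2 * Nat.card (Region w) = w.length + 4

/-! ## Colorings by a quandle

Mathlib writes `y ◃ x` for the product often denoted by `x * y`. -/

/-- An oriented plane knot diagram with a color on each edge: `outer` is the side of the base edge on
which the unbounded region lies, `base` the color of the base edge, and `passes` the Gauss word, each
letter of which comes with the color of the edge that follows it. -/
structure ColoredDiagram (X : Type*) where
  outer : Side
  base : X
  passes : List (Pass × X)

/-- The underlying Gauss word. -/
def passWord {X : Type*} (L : List (Pass × X)) : List Pass := L.map Prod.fst

/-- The color of the last edge of a path that starts on an edge of color `x`. -/
def lastColor {X : Type*} (x : X) (L : List (Pass × X)) : X := (L.map Prod.snd).getLastD x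

/-- The coloring condition along a path `t` that starts on an edge of color `x`, the colors of upper
strands being looked up in `L`. The color does not change along an upper strand, so that colors of
edges are colors of arcs. If the arc passed below has color `y`, then the lower arc on its right, of
color `x`, and the one on its left, of color `x'`, satisfy `x' = y ◃ x`. -/
def FollowsColoringRule {X : Type*} [Quandle X] (L : List (Pass × X)) :
    X → List (Pass × X) → Prop
  | _, [] => True
  | x, (⟨_, true⟩, z) :: t => z = x ∧ FollowsColoringRule L z t
  | x, (⟨c, false⟩, z) :: t =>
      (∃ y, ((⟨c, true⟩ : Pass), y) ∈ L ∧
        (if c.positive then z = Quandle.toRack.act y x else x = Quandle.toRack.act y z)) ∧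
      FollowsColoringRule L z t

/-- A knot diagram with a coloring by the quandle `X`. -/
structure ColoredDiagram.IsColoring {X : Type*} [Quandle X] (D : ColoredDiagram X) : Prop where
  isKnotWord : IsKnotWord (passWord D.passes)
  rule : FollowsColoringRule D.passes D.base D.passes
  closed : lastColor D.base D.passes = D.base

/-! ## Reidemeister moves and planar isotopies -/

/-- `1` or `-1` according to the sign of the crossing. -/
def Crossing.sign (c : Crossing) : ℤ := if c.positive then 1 else -1

/-- The two passages `P` happen in the order `P.1`, `P.2` if `o = 1`, in the other one if `o = -1`. -/
def inOrder (o : ℤˣ) (P : Pass × Pass) : Pass × Pass := if o = 1 then P else P.swap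

/-- Moves of colored diagrams. Edges that do not take part in a move keep their colors, and the
colors of the others are only restricted by the coloring condition, imposed in `RStep`. -/
inductive Move {X : Type*} : ColoredDiagram X → ColoredDiagram X → Prop
  /-- Planar isotopy, first part: the names of the crossings are irrelevant. -/
  | rename (f : Crossing → Crossing) (hf : Function.Injective f)
      (hsign : ∀ c, (f c).positive = c.positive) (s : Side) (x : X) (L : List (Pass × X)) :
      Move ⟨s, x, L⟩ ⟨s, x, L.map fun a => (⟨f a.1.crossing, a.1.isOver⟩, a.2)⟩
  /-- Planar isotopy, second part: the base point may be any point that borders the unbounded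
  region. -/
  | rebase (s s' : Side) (x : X) (u v : List (Pass × X))
      (h : regionAt (passWord (u ++ v)) (0, s) = regionAt (passWord (u ++ v)) (u.length, s')) :
      Move ⟨s, x, u ++ v⟩ ⟨s', lastColor x u, v ++ u⟩
  /-- First Reidemeister move: a loop with one crossing is created. -/
  | reidemeister1 (c : Crossing) (o : Bool) (s : Side) (x y z : X) (u v : List (Pass × X)) :
      Move ⟨s, x, u ++ v⟩ ⟨s, x, u ++ [(⟨c, o⟩, y), (⟨c, !o⟩, z)] ++ v⟩
  /-- Second Reidemeister move: two strands get to cross each other in `c` and `d`. The pairs `P`, `Q`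
  are the passages on the two strands, in the order in which the knot runs through the strands. -/
  | reidemeister2 (c d : Crossing) (hsign : c.positive = !d.positive) (o : ℤˣ) (P Q : Pass × Pass)
      (hPQ : [P, Q].Perm [(⟨c, true⟩, ⟨d, true⟩), inOrder o (⟨c, false⟩, ⟨d, false⟩)])
      (s : Side) (x y₁ y₂ z₁ z₂ : X) (u v w : List (Pass × X)) :
      Move ⟨s, x, u ++ v ++ w⟩
        ⟨s, x, u ++ [(P.1, y₁), (P.2, y₂)] ++ v ++ [(Q.1, z₁), (Q.2, z₂)] ++ w⟩
  /-- Third Reidemeister move: crossings `a` (top over middle strand), `b` (top over bottom) and `c`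
  (middle over bottom) form a triangle, which is turned over; `o₁`, `o₂`, `o₃` say in which order the
  three strands run through their two crossings. The condition `hsign` says that these orders and the
  signs are those of three straight lines in the plane. The pairs `P`, `Q`, `R` are the passages on
  the three strands, in the order in which the knot runs through the strands. -/
  | reidemeister3 (a b c : Crossing) (o₁ o₂ o₃ : ℤˣ)
      (hsign : ∃ e : ℤˣ, (o₁ : ℤ) = e * a.sign * b.sign ∧ (o₂ : ℤ) = e * a.sign * c.sign ∧
        (o₃ : ℤ) = e * b.sign * c.sign)
      (P Q R : Pass × Pass)
      (hPQR : [P, Q, R].Perm [inOrder o₁ (⟨a, true⟩, ⟨b, true⟩),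
        inOrder o₂ (⟨a, false⟩, ⟨c, true⟩), inOrder o₃ (⟨b, false⟩, ⟨c, false⟩)])
      (s : Side) (x y₁ y₁' y₂ z₁ z₁' z₂ r₁ r₁' r₂ : X) (u v w t : List (Pass × X)) :
      Move
        ⟨s, x, u ++ [(P.1, y₁), (P.2, y₂)] ++ v ++ [(Q.1, z₁), (Q.2, z₂)] ++ w ++
          [(R.1, r₁), (R.2, r₂)] ++ t⟩
        ⟨s, x, u ++ [(P.2, y₁'), (P.1, y₂)] ++ v ++ [(Q.2, z₁'), (Q.1, z₂)] ++ w ++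
          [(R.2, r₁'), (R.1, r₂)] ++ t⟩

/-- A colored diagram is turned into another one by a Reidemeister move or a planar isotopy. -/
def RStep {X : Type*} [Quandle X] (D D' : ColoredDiagram X) : Prop :=
  D.IsColoring ∧ D'.IsColoring ∧ Move D D'

/-- R-equivalence: a finite sequence of Reidemeister moves and planar isotopies, and of their
inverses, leads from one colored diagram to the other. -/
def REquivalent {X : Type*} [Quandle X] : ColoredDiagram X → ColoredDiagram X → Prop :=
  Relation.EqvGen RStep

/-! ## The quandle of rotations of the Euclidean plane -/

/-- The rotation of the plane about `center` by the angle that `angle` represents. -/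
@[ext] structure RotE2 where
  center : ℂ
  angle : Circle

noncomputable instance : Quandle RotE2 where
  act y x := ⟨(x.center - y.center) * (y.angle : ℂ) + y.center, x.angle⟩
  self_distrib := by
    intro x y z
    ext
    · simp only
      ring
    · rfl
  invAct y x := ⟨(x.center - y.center) * ((y.angle⁻¹ : Circle) : ℂ) + y.center, x.angle⟩
  left_inv := by
    intro y x
    ext
    · have h : (y.angle : ℂ) * ((y.angle⁻¹ : Circle) : ℂ) = 1 := by
        rw [← Circle.coe_mul]
        simp
      simp only
      linear_combination (x.center - y.center) * h
    · rfl
  right_inv := by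
    intro y x
    ext
    · have h : (y.angle : ℂ) * ((y.angle⁻¹ : Circle) : ℂ) = 1 := by
        rw [← Circle.coe_mul]
        simp
      simp only
      linear_combination (x.center - y.center) * h
    · rfl
  fix := by
    intro x
    ext <;> simp

/-! ## The standard diagram of a torus knot

For `m` strands, in places `0, …, m - 1` from left to right, and `n` repetitions, all strands going
upwards: in repetition `i` (an integer modulo `n`) the strand in place `0` goes over all the others to
place `m - 1`, each of the others moving one place to the left. The braid is closed up on the right.
Let `a i j` be the arc in place `j` at the beginning of repetition `i`, so that `a i 0` is also
`a (i + 1) (m - 1)`. In the crossing named `(i, j)`, for `1 ≤ j ≤ m - 1`, the arc `a i 0` goes over,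
while `a i j` and `a (i + 1) (j - 1)` are the arcs below. -/

/-- The passages in the order in which they are met from `a 0 0` on, as pairs of a name of a crossing
and a Boolean telling whether the passage is an upper one. From `a i 0` on, the knot goes over the
crossings `(i, 1)`, …, `(i, m - 1)`, then under `(i + 1, m - 1)`, …, `(i + m - 1, 1)`, to `a (i + m) 0`. -/
def torusPasses (m n : ℕ) : List ((ℕ × ℕ) × Bool) :=
  (List.range n).flatMap fun t =>
    ((List.range' 1 (m - 1)).map fun j => ((t * m % n, j), true)) ++
    ((List.range' 1 (m - 1)).map fun r => (((t * m + r) % n, m - r), false))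

/-- The diagram of the `(p, q)`-torus knot, the arc `a i j` having the color `col i j`
(`0 ≤ i < |q|`, `0 ≤ j < |p|`). If `p * q > 0`, it is the closed braid above; if `p * q < 0`, it is the
mirror image of the latter in a line of the plane, with the reverse orientation. In both cases the
arc `a i j` is on the right and `a (i + 1) (j - 1)` on the left of `a i 0`. -/
def torusColored {X : Type*} (p q : ℤ) (col : ℕ → ℕ → X) : ColoredDiagram X where
  outer := .left
  base := col 0 0
  passes :=
    if 0 < p * q then
      (torusPasses p.natAbs q.natAbs).map fun a =>
        (⟨⟨a.1, true⟩, a.2⟩,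
          if a.2 then col a.1.1 0 else col ((a.1.1 + 1) % q.natAbs) (a.1.2 - 1))
    else
      (torusPasses p.natAbs q.natAbs).reverse.map fun a =>
        (⟨⟨a.1, false⟩, a.2⟩, if a.2 then col a.1.1 0 else col a.1.1 a.1.2)

/-! ## Trochoids -/

/-- `v` lists (periodically) the vertices of a regular polygon of type `(m, k)`: it runs through the
vertices of a convex regular `m`-gon, going on by `k` vertices counterclockwise at each step. -/
def IsRegularPolygon (m k : ℕ) (v : ℕ → ℂ) : Prop :=
  ∃ c ρ : ℂ, ρ ≠ 0 ∧ ∀ i : ℕ, v i = c + ρ * Complex.exp (2 * Real.pi * (k * i / m : ℝ) * I)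

/-- The side length of a regular polygon with vertices `v`. -/
noncomputable def sideLength (v : ℕ → ℂ) : ℝ := dist (v 0) (v 1)

/-- The angle of rotation in an `(m, k; n, l)`-trochoid. -/
noncomputable def trochoidAngle (m k n l : ℕ) : ℝ :=
  (((m : ℝ) - 2 * k) / m - ((n : ℝ) - 2 * l) / n) * Real.pi

/-- A regular polygon `Q` of type `(n, l)` with vertices `v` and a regular polygon `P₀` of type `(m, k)`
with vertices `w` that share their first two vertices: an `(m, k; n, l)`-trochoid around `Q` starting
at `P₀`. -/
structure IsTrochoid (m k n l : ℕ) (v w : ℕ → ℂ) : Prop where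
  polygon_center : IsRegularPolygon n l v
  polygon_start : IsRegularPolygon m k w
  vertex_zero : w 0 = v 0
  vertex_one : w 1 = v 1

/-- The vertex of index `j` of the polygon `P i` of the trochoid: `P (i + 1)` is obtained from `P i` by
the rotation about `v (i + 1)` by the angle of the trochoid. -/
noncomputable def trochoidVertex (m k n l : ℕ) (v w : ℕ → ℂ) : ℕ → ℕ → ℂ
  | 0, j => w j
  | i + 1, j =>
      (trochoidVertex m k n l v w i j - v (i + 1)) * Complex.exp (trochoidAngle m k n l * I) + v (i + 1)

/-- The coloring of the diagram of the `(p, q)`-torus knot derived from a trochoid: the color of the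
arc `a i j` is the rotation about the vertex of index `i + j + 1` of `P i` by the angle of the
trochoid. -/
noncomputable def trochoidColored (p q : ℤ) (k l : ℕ) (v w : ℕ → ℂ) : ColoredDiagram RotE2 :=
  torusColored p q fun i j =>
    ⟨trochoidVertex p.natAbs k q.natAbs l v w i (i + j + 1),
      Circle.exp (trochoidAngle p.natAbs k q.natAbs l)⟩

/-! The proof attaches to every `RotE2`-colored diagram a real number, its *area*: the sum, over all
lower passages, of `ω(y, x' - x)`, where `y` is the center of the color above, `x` and `x'` are the
centers of the colors before and after the passage, and `ω(z, w) = Im (conj z * w)`.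

The area is unchanged by the moves (`area_eq_of_rEquivalent`). The rotation by the color `y` lifts to
the permutation `(x, s) ↦ (y ◃ x, s + ω(y, (y ◃ x) - x))` of `RotE2 × ℝ`, and the color `y ◃ z` lifts
to the conjugate of the lift of `z` by that of `y` (`liftAct_act`). Running once along the knot and
composing the lifts of the upper colors, with signs, takes `(x, 0)` to `(x, area)` if `x` is the color
of the base edge. Second and third Reidemeister moves do not change the composition at all, by identities
in the permutation group; first Reidemeister moves do not change its value at `(x, 0)`, because the lift
of `y` fixes `(y, s)`. Neither planarity of the diagrams nor the unbounded region plays a role.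

For a trochoid put `ζ = exp (2πil/n)` and `ξ = exp (2πik/m)`. If `v i = c + ρ ζ ^ i`, then the arc
`a i j` has center `c + ζ ^ i (γ + σ ξ ^ (j + 1))` with `γ + σ = ρ` and `γ + σ ξ = ρ ζ`. In block `i`
the lower passages take place under a single arc, so that their contributions add up, and the area is
`± m n |ρ|² ω(ζ, (ξ - ζ) / (ξ - 1) * (ζ - 1))` (`exists_area_trochoidColored`). The last factor depends
on `m, k, n, l` only. It is not zero, because `conj ζ * (ξ - ζ) / (ξ - 1) * (ζ - 1)` is purely imaginary
and `ξ ≠ ζ` by coprimality (`trochoidConst_ne_zero`). Hence the area determines `|ρ|`, and with it the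
side length `|ρ| |1 - ζ|`. -/

/-! ### The lift of the quandle action -/

/-- The standard area form of the plane, `Im (conj z * w)`. -/
noncomputable def areaForm (z w : ℂ) : ℝ := z.re * w.im - z.im * w.re

lemma RotE2.act_center (y x : RotE2) :
    (Quandle.toRack.act y x).center = (x.center - y.center) * (y.angle : ℂ) + y.center := rfl

lemma RotE2.act_angle (y x : RotE2) : (Quandle.toRack.act y x).angle = x.angle := rfl

/-- The lift of the action of `y` to `RotE2 × ℝ`: if the center of a color
moves from `x` to `x'`, then the real coordinate grows by `ω(y, x' - x)`, `ω` being the area form. -/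
noncomputable def liftAct (y : RotE2) : Equiv.Perm (RotE2 × ℝ) where
  toFun p := (Quandle.toRack.act y p.1,
    p.2 + areaForm y.center ((Quandle.toRack.act y p.1).center - p.1.center))
  invFun p := (Rack.invAct y p.1,
    p.2 - areaForm y.center (p.1.center - (Rack.invAct y p.1).center))
  left_inv p := by
    have h : Rack.invAct y (Quandle.toRack.act y p.1) = p.1 := Rack.left_inv y p.1
    ext1 <;> simp [h]
  right_inv p := by
    have h : Quandle.toRack.act y (Rack.invAct y p.1) = p.1 := Rack.right_inv y p.1
    ext1 <;> simp [h]

lemma liftAct_apply (y x : RotE2) (s : ℝ) : liftAct y (x, s) =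
    (Quandle.toRack.act y x, s + areaForm y.center ((Quandle.toRack.act y x).center - x.center)) :=
  rfl

/-- The lift is compatible with the quandle product. In the real coordinate this says that the area form
is preserved by the rotation of `y`, that is, that `y.angle` has modulus one. -/
lemma liftAct_act (y z : RotE2) :
    liftAct (Quandle.toRack.act y z) = liftAct y * liftAct z * (liftAct y)⁻¹ := by
  rw [eq_mul_inv_iff_mul_eq]
  ext1 ⟨x, s⟩
  have hy : (y.angle : ℂ).re ^ 2 + (y.angle : ℂ).im ^ 2 = 1 := by
    have := Circle.normSq_coe y.angle
    rw [normSq_apply] at this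
    linarith
  simp only [Equiv.Perm.mul_apply, liftAct_apply]
  ext1
  · exact (Shelf.self_distrib (x := y) (y := z) (z := x)).symm
  · simp only [areaForm, RotE2.act_center, RotE2.act_angle, add_re, add_im, sub_re, sub_im, mul_re,
      mul_im]
    generalize (y.angle : ℂ) = t at hy ⊢
    generalize (z.angle : ℂ) = u
    linear_combination hy *
      ((z.center.re - y.center.re) * ((x.center.re - z.center.re) * u.im
          + (x.center.im - z.center.im) * (u.re - 1))
        - (z.center.im - y.center.im) * ((x.center.re - z.center.re) * (u.re - 1)
          - (x.center.im - z.center.im) * u.im))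

lemma liftAct_self (y : RotE2) (s : ℝ) : liftAct y (y, s) = (y, s) := by
  simp [liftAct_apply, areaForm]

/-! ### Transport along a path -/

/-- The lift of a passage, `col` telling the color of the upper strand of each crossing: the identity for
an upper passage, the lift of the upper color or its inverse for a lower one, according to the sign. -/
noncomputable def passLift (col : Crossing → RotE2) (P : Pass) : Equiv.Perm (RotE2 × ℝ) :=
  if P.isOver then 1 else liftAct (col P.crossing) ^ P.crossing.sign

/-- The composition of the lifts of the passages of a path, the first letter being applied first. -/
noncomputable def wordLift (col : Crossing → RotE2) : List Pass → Equiv.Perm (RotE2 × ℝ)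
  | [] => 1
  | P :: w => wordLift col w * passLift col P

lemma wordLift_append (col : Crossing → RotE2) (u v : List Pass) :
    wordLift col (u ++ v) = wordLift col v * wordLift col u := by
  induction u with
  | nil => simp [wordLift]
  | cons P u ih => simp [wordLift, ih, mul_assoc]

@[simp] lemma passLift_over (col : Crossing → RotE2) (c : Crossing) :
    passLift col ⟨c, true⟩ = 1 := by simp [passLift]

@[simp] lemma passLift_under (col : Crossing → RotE2) (c : Crossing) :
    passLift col ⟨c, false⟩ = liftAct (col c) ^ c.sign := by simp [passLift]

lemma wordLift_congr {col col' : Crossing → RotE2} {w : List Pass}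
    (h : ∀ c : Crossing, (⟨c, false⟩ : Pass) ∈ w → col c = col' c) :
    wordLift col w = wordLift col' w := by
  induction w with
  | nil => rfl
  | cons P w ih =>
    have h1 : passLift col P = passLift col' P := by
      obtain ⟨c, _ | _⟩ := P
      · simp [h c (by simp)]
      · simp
    rw [wordLift, wordLift, h1, ih fun c hc => h c (List.mem_cons_of_mem _ hc)]

/-- The sum of `ω(y, x' - x)` over the lower passages of a path that starts on an edge of color `x`; the
colors `y` of the upper strands are given by `col`. -/
noncomputable def pathArea (col : Crossing → RotE2) : RotE2 → List (Pass × RotE2) → ℝ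
  | _, [] => 0
  | x, (P, z) :: t =>
      (if P.isOver then 0 else areaForm (col P.crossing).center (z.center - x.center)) +
        pathArea col z t

lemma lastColor_cons {X : Type*} (x : X) (a : Pass × X) (L : List (Pass × X)) :
    lastColor x (a :: L) = lastColor a.2 L := by
  simp only [lastColor, List.map_cons]
  cases h : L.map Prod.snd <;> simp [List.getLastD]

lemma lastColor_append {X : Type*} (x : X) (u v : List (Pass × X)) :
    lastColor x (u ++ v) = lastColor (lastColor x u) v := by
  induction u generalizing x with
  | nil => rfl
  | cons a u ih => rw [List.cons_append, lastColor_cons, ih, lastColor_cons]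

lemma pathArea_append (col : Crossing → RotE2) (x : RotE2) (u v : List (Pass × RotE2)) :
    pathArea col x (u ++ v) = pathArea col x u + pathArea col (lastColor x u) v := by
  induction u generalizing x with
  | nil => simp [pathArea, lastColor]
  | cons a u ih => rw [List.cons_append, lastColor_cons, pathArea, pathArea, ih, add_assoc]

lemma pathArea_congr {col col' : Crossing → RotE2} {x : RotE2} {t : List (Pass × RotE2)}
    (h : ∀ c : Crossing, (⟨c, false⟩ : Pass) ∈ passWord t → col c = col' c) :
    pathArea col x t = pathArea col' x t := by
  induction t generalizing x with
  | nil => rfl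
  | cons a t ih =>
    obtain ⟨⟨c, _ | _⟩, z⟩ := a
    · rw [pathArea, pathArea, h c (by simp [passWord]),
        ih fun c hc => h c (List.mem_cons_of_mem _ hc)]
    · rw [pathArea, pathArea, ih fun c hc => h c (List.mem_cons_of_mem _ hc)]
      simp

lemma followsColoringRule_append {X : Type*} [Quandle X] (L : List (Pass × X)) (x : X)
    (u v : List (Pass × X)) : FollowsColoringRule L x (u ++ v) ↔
      FollowsColoringRule L x u ∧ FollowsColoringRule L (lastColor x u) v := by
  induction u generalizing x with
  | nil => simp [FollowsColoringRule, lastColor]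
  | cons a u ih =>
    obtain ⟨⟨c, _ | _⟩, z⟩ := a <;>
      simp only [List.cons_append, lastColor_cons, FollowsColoringRule, ih, and_assoc]

/-- `col` gives the color in `L` of the upper strand of each crossing that occurs. -/
def IsOverColor (L : List (Pass × RotE2)) (col : Crossing → RotE2) : Prop :=
  ∀ c y, ((⟨c, true⟩ : Pass), y) ∈ L → col c = y

lemma passLift_apply_of_rule (col : Crossing → RotE2) (c : Crossing) (x z : RotE2) (s : ℝ)
    (h : if c.positive then z = Quandle.toRack.act (col c) x
      else x = Quandle.toRack.act (col c) z) :
    (liftAct (col c) ^ c.sign) (x, s) =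
      (z, s + areaForm (col c).center (z.center - x.center)) := by
  obtain ⟨n, _ | _⟩ := c
  · simp only [Bool.false_eq_true, if_false] at h
    simp only [Crossing.sign, Bool.false_eq_true, if_false, zpow_neg, zpow_one]
    rw [Equiv.Perm.inv_eq_iff_eq, liftAct_apply, ← h]
    ext1
    · rfl
    · simp only [areaForm, sub_re, sub_im]
      ring
  · simp only [if_true] at h
    simp only [Crossing.sign, if_true, zpow_one]
    rw [liftAct_apply, ← h]

/-- Along a colored path the lift runs through the colors of the edges and adds up the area. -/
lemma wordLift_apply {L : List (Pass × RotE2)} {col : Crossing → RotE2}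
    (hcol : IsOverColor L col) {x : RotE2} {t : List (Pass × RotE2)}
    (h : FollowsColoringRule L x t) (s : ℝ) :
    wordLift col (passWord t) (x, s) = (lastColor x t, s + pathArea col x t) := by
  induction t generalizing x s with
  | nil => simp [passWord, wordLift, pathArea, lastColor]
  | cons a t ih =>
    obtain ⟨⟨c, _ | _⟩, z⟩ := a
    · obtain ⟨⟨y, hy, hz⟩, ht⟩ := h
      rw [← hcol c y hy] at hz
      have := passLift_apply_of_rule col c x z s hz
      simp only [passWord, List.map_cons, wordLift, Equiv.Perm.mul_apply, passLift_under] at ih ⊢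
      rw [this, ih ht, lastColor_cons, pathArea]
      simp [add_assoc]
    · obtain ⟨hz, ht⟩ := h
      subst hz
      simp only [passWord, List.map_cons, wordLift, Equiv.Perm.mul_apply, passLift_over] at ih ⊢
      rw [Equiv.Perm.one_apply, ih ht, lastColor_cons, pathArea]
      simp

/-- The color in `L` of the upper strand of a crossing; the value for a crossing that does not occur
is irrelevant. -/
noncomputable def overColor (L : List (Pass × RotE2)) (c : Crossing) : RotE2 :=
  ((L.find? fun a => a.1 = ⟨c, true⟩).map Prod.snd).getD ⟨0, 1⟩

lemma overColor_mem {L : List (Pass × RotE2)} {c : Crossing}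
    (h : (⟨c, true⟩ : Pass) ∈ passWord L) : ((⟨c, true⟩ : Pass), overColor L c) ∈ L := by
  obtain ⟨a, ha, hac⟩ := List.mem_map.1 h
  cases hf : L.find? fun a => a.1 = ⟨c, true⟩ with
  | none => exact absurd hac (by simpa using List.find?_eq_none.1 hf a ha)
  | some b =>
    have hb : b.1 = ⟨c, true⟩ := by simpa using List.find?_some hf
    have hm := List.mem_of_find?_eq_some hf
    rw [overColor, hf, ← hb]
    exact hm

lemma eq_of_mem_of_nodup {X : Type*} {L : List (Pass × X)} (h : (passWord L).Nodup) {P : Pass}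
    {y z : X} (hy : (P, y) ∈ L) (hz : (P, z) ∈ L) : y = z :=
  congrArg Prod.snd (List.inj_on_of_nodup_map h hy hz rfl)

lemma isOverColor_overColor {L : List (Pass × RotE2)} (h : (passWord L).Nodup) :
    IsOverColor L (overColor L) := fun _ _ hy =>
  eq_of_mem_of_nodup h (overColor_mem (List.mem_map.2 ⟨_, hy, rfl⟩)) hy

/-- The area of a colored diagram: the sum of `ω(y, x' - x)` over all lower passages. -/
noncomputable def ColoredDiagram.area (D : ColoredDiagram RotE2) : ℝ :=
  pathArea (overColor D.passes) D.base D.passes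

lemma ColoredDiagram.IsColoring.wordLift_apply {D : ColoredDiagram RotE2} (h : D.IsColoring) :
    wordLift (overColor D.passes) (passWord D.passes) (D.base, 0) = (D.base, D.area) := by
  rw [_root_.wordLift_apply (isOverColor_overColor h.isKnotWord.nodup) h.rule, h.closed, zero_add,
    ColoredDiagram.area]

lemma area_eq_of_wordLift {D D' : ColoredDiagram RotE2} (h : D.IsColoring) (h' : D'.IsColoring)
    (hb : D.base = D'.base)
    (hw : wordLift (overColor D.passes) (passWord D.passes) (D.base, 0) =
      wordLift (overColor D'.passes) (passWord D'.passes) (D.base, 0)) : D.area = D'.area := by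
  rw [h.wordLift_apply, hb, h'.wordLift_apply] at hw
  exact congrArg Prod.snd hw

/-- The upper colors of old crossings survive when passages are added. -/
lemma overColor_eq_of_subset {L L' : List (Pass × RotE2)} (h : IsKnotWord (passWord L))
    (h' : IsKnotWord (passWord L')) (hs : L ⊆ L') (c : Crossing)
    (hc : (⟨c, false⟩ : Pass) ∈ passWord L) : overColor L c = overColor L' c :=
  (isOverColor_overColor h'.nodup c _
    (hs (overColor_mem ((h.over_iff_under c).2 hc)))).symm

/-! ### Invariance under the moves -/

lemma area_rename (f : Crossing → Crossing) (s : Side)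
    (x : RotE2) (L : List (Pass × RotE2)) (h : (⟨s, x, L⟩ : ColoredDiagram RotE2).IsColoring)
    (h' : (⟨s, x, L.map fun a => (⟨f a.1.crossing, a.1.isOver⟩, a.2)⟩ :
      ColoredDiagram RotE2).IsColoring) :
    (⟨s, x, L⟩ : ColoredDiagram RotE2).area =
      (⟨s, x, L.map fun a => (⟨f a.1.crossing, a.1.isOver⟩, a.2)⟩ : ColoredDiagram RotE2).area := by
  have key (col : Crossing → RotE2) (t : List (Pass × RotE2)) (x : RotE2) :
      pathArea col x (t.map fun a => (⟨f a.1.crossing, a.1.isOver⟩, a.2)) =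
        pathArea (col ∘ f) x t := by
    induction t generalizing x with
    | nil => rfl
    | cons a t ih => simp [pathArea, ih]
  rw [ColoredDiagram.area, ColoredDiagram.area, key]
  refine pathArea_congr fun c hc => ?_
  have hm := overColor_mem ((h.isKnotWord.over_iff_under c).2 hc)
  exact (isOverColor_overColor h'.isKnotWord.nodup (f c) _ (List.mem_map.2 ⟨_, hm, rfl⟩)).symm

lemma area_rebase (s s' : Side) (x : RotE2) (u v : List (Pass × RotE2))
    (h : (⟨s, x, u ++ v⟩ : ColoredDiagram RotE2).IsColoring)
    (h' : (⟨s', lastColor x u, v ++ u⟩ : ColoredDiagram RotE2).IsColoring) :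
    (⟨s, x, u ++ v⟩ : ColoredDiagram RotE2).area =
      (⟨s', lastColor x u, v ++ u⟩ : ColoredDiagram RotE2).area := by
  have hc := h.closed
  simp only [lastColor_append] at hc
  have hcol : ∀ c : Crossing, (⟨c, false⟩ : Pass) ∈ passWord (u ++ v) →
      overColor (u ++ v) c = overColor (v ++ u) c :=
    overColor_eq_of_subset h.isKnotWord h'.isKnotWord fun a ha => by
      simpa [or_comm] using ha
  simp only [ColoredDiagram.area]
  rw [pathArea_congr hcol, pathArea_append, pathArea_append, hc, add_comm]

lemma area_reidemeister1 (c : Crossing) (o : Bool) (s : Side) (x y z : RotE2)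
    (u v : List (Pass × RotE2)) (h : (⟨s, x, u ++ v⟩ : ColoredDiagram RotE2).IsColoring)
    (h' : (⟨s, x, u ++ [(⟨c, o⟩, y), (⟨c, !o⟩, z)] ++ v⟩ : ColoredDiagram RotE2).IsColoring) :
    (⟨s, x, u ++ v⟩ : ColoredDiagram RotE2).area =
      (⟨s, x, u ++ [(⟨c, o⟩, y), (⟨c, !o⟩, z)] ++ v⟩ : ColoredDiagram RotE2).area := by
  set L' := u ++ [(⟨c, o⟩, y), (⟨c, !o⟩, z)] ++ v with hL'
  have hover := isOverColor_overColor h'.isKnotWord.nodup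
  simp only at hover
  have hcol : ∀ d : Crossing, (⟨d, false⟩ : Pass) ∈ passWord (u ++ v) →
      overColor (u ++ v) d = overColor L' d :=
    overColor_eq_of_subset h.isKnotWord h'.isKnotWord fun a ha => by
      simp only [hL', List.mem_append] at ha ⊢; tauto
  have hrule := h'.rule
  simp only at hrule
  nth_rw 2 [hL'] at hrule
  rw [followsColoringRule_append, followsColoringRule_append] at hrule
  obtain ⟨⟨hu, hm⟩, -⟩ := hrule
  refine area_eq_of_wordLift h h' rfl ?_
  simp only
  have hword : passWord L' = passWord u ++ [⟨c, o⟩, ⟨c, !o⟩] ++ passWord v := by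
    simp [hL', passWord]
  have hword₀ : passWord (u ++ v) = passWord u ++ passWord v := by simp [passWord]
  rw [wordLift_congr hcol, hword, hword₀]
  simp only [wordLift_append, Equiv.Perm.mul_apply]
  congr 1
  rw [wordLift_apply hover hu 0]
  -- the strand of the loop meets itself, so that it is rotated about its own center
  have hfix : overColor L' c = lastColor x u := by
    cases o with
    | true => exact (hover c y (by simp [hL'])).trans hm.1
    | false =>
      obtain ⟨⟨w, hw, hr⟩, hz, -⟩ := hm
      have hwz : w = y := by
        rw [← hover c w hw, hover c z (by simp [hL'])]
        exact hz
      subst hwz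
      rw [hover c w hw]
      split_ifs at hr
      · have h2 : Quandle.toRack.act w w = w := Quandle.fix
        exact (Rack.left_cancel w).1 (h2.trans hr)
      · rw [hr]
        exact (Quandle.fix).symm
  have hpow (n : ℤ) (t : ℝ) : (liftAct (lastColor x u) ^ n) (lastColor x u, t) =
      (lastColor x u, t) :=
    Equiv.Perm.zpow_apply_eq_self_of_apply_eq_self (liftAct_self _ _) n
  cases o <;> simp [wordLift, hfix, hpow]

lemma forall_mem_iff_of_perm {l l' : List (Pass × Pass)} (h : l.Perm l') {p : Pass × Pass → Prop} :
    (∀ S ∈ l, p S) ↔ ∀ S ∈ l', p S :=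
  ⟨fun H S hS => H S (h.mem_iff.2 hS), fun H S hS => H S (h.mem_iff.1 hS)⟩

lemma inOrder_cases (o : ℤˣ) (P : Pass × Pass) :
    o = 1 ∧ inOrder o P = P ∨ o = -1 ∧ inOrder o P = P.swap := by
  rcases Int.units_eq_one_or o with rfl | rfl
  · exact Or.inl ⟨rfl, by simp [inOrder]⟩
  · exact Or.inr ⟨rfl, by simp [inOrder]⟩

lemma Crossing.sign_eq (c : Crossing) :
    c.positive = true ∧ c.sign = 1 ∨ c.positive = false ∧ c.sign = -1 := by
  obtain ⟨n, _ | _⟩ := c <;> simp [Crossing.sign]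

/-- The two passages of the upper strand act trivially, those of the lower strand are rotations about the
same center in opposite directions. -/
lemma area_reidemeister2 (c d : Crossing) (hsign : c.positive = !d.positive) (o : ℤˣ)
    (P Q : Pass × Pass)
    (hPQ : [P, Q].Perm [(⟨c, true⟩, ⟨d, true⟩), inOrder o (⟨c, false⟩, ⟨d, false⟩)])
    (s : Side) (x y₁ y₂ z₁ z₂ : RotE2) (u v w : List (Pass × RotE2))
    (h : (⟨s, x, u ++ v ++ w⟩ : ColoredDiagram RotE2).IsColoring)
    (h' : (⟨s, x, u ++ [(P.1, y₁), (P.2, y₂)] ++ v ++ [(Q.1, z₁), (Q.2, z₂)] ++ w⟩ :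
      ColoredDiagram RotE2).IsColoring) :
    (⟨s, x, u ++ v ++ w⟩ : ColoredDiagram RotE2).area =
      (⟨s, x, u ++ [(P.1, y₁), (P.2, y₂)] ++ v ++ [(Q.1, z₁), (Q.2, z₂)] ++ w⟩ :
        ColoredDiagram RotE2).area := by
  set L' := u ++ [(P.1, y₁), (P.2, y₂)] ++ v ++ [(Q.1, z₁), (Q.2, z₂)] ++ w with hL'
  have hover := isOverColor_overColor h'.isKnotWord.nodup
  simp only at hover
  have hcol : ∀ e : Crossing, (⟨e, false⟩ : Pass) ∈ passWord (u ++ v ++ w) →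
      overColor (u ++ v ++ w) e = overColor L' e :=
    overColor_eq_of_subset h.isKnotWord h'.isKnotWord fun a ha => by
      simp only [hL', List.mem_append] at ha ⊢; tauto
  have hrule := h'.rule
  simp only at hrule
  nth_rw 2 [hL'] at hrule
  simp only [followsColoringRule_append] at hrule
  obtain ⟨⟨⟨⟨-, hP⟩, -⟩, hQ⟩, -⟩ := hrule
  have hdata : ∀ S ∈ [P, Q], ∃ a b₁ b₂, (S.1, b₁) ∈ L' ∧ (S.2, b₂) ∈ L' ∧
      FollowsColoringRule L' a [(S.1, b₁), (S.2, b₂)] := by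
    simp only [List.mem_cons, List.not_mem_nil, or_false, forall_eq_or_imp, forall_eq]
    exact ⟨⟨_, y₁, y₂, by simp [hL'], by simp [hL'], hP⟩,
      ⟨_, z₁, z₂, by simp [hL'], by simp [hL'], hQ⟩⟩
  have hcd : overColor L' c = overColor L' d := by
    obtain ⟨a, b₁, b₂, h1, h2, -, h3, -⟩ :=
      (forall_mem_iff_of_perm hPQ).1 hdata (⟨c, true⟩, ⟨d, true⟩) (by simp)
    rw [hover c b₁ h1, hover d b₂ h2, h3]
  have hone : ∀ S ∈ [P, Q], wordLift (overColor L') [S.1, S.2] = 1 := by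
    refine (forall_mem_iff_of_perm hPQ).2 ?_
    simp only [List.mem_cons, List.not_mem_nil, or_false, forall_eq_or_imp, forall_eq]
    refine ⟨by simp [wordLift], ?_⟩
    rcases inOrder_cases o (⟨c, false⟩, ⟨d, false⟩) with ⟨-, ho⟩ | ⟨-, ho⟩ <;>
      rcases c.sign_eq with ⟨hc, hc'⟩ | ⟨hc, hc'⟩ <;> rcases d.sign_eq with ⟨hd, hd'⟩ | ⟨hd, hd'⟩ <;>
        simp [hc, hd] at hsign <;> simp [ho, wordLift, hcd, hc', hd']
  refine area_eq_of_wordLift h h' rfl ?_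
  simp only
  have hword : passWord L' =
      passWord u ++ [P.1, P.2] ++ passWord v ++ [Q.1, Q.2] ++ passWord w := by
    simp [hL', passWord]
  have hword₀ : passWord (u ++ v ++ w) = passWord u ++ passWord v ++ passWord w := by
    simp [passWord]
  rw [wordLift_congr hcol, hword, hword₀]
  simp only [wordLift_append, hone P (by simp), hone Q (by simp), one_mul]

/-- The lifts of the colors before and after a lower passage are conjugate by the lift of the passage. -/
lemma liftAct_mul_of_rule (c : Crossing) {x y z : RotE2}
    (h : if c.positive then z = Quandle.toRack.act y x else x = Quandle.toRack.act y z) :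
    liftAct z * liftAct y ^ c.sign = liftAct y ^ c.sign * liftAct x := by
  rcases c.sign_eq with ⟨hc, hc'⟩ | ⟨hc, hc'⟩ <;> simp [hc] at h <;> rw [h, hc', liftAct_act] <;>
    simp [mul_assoc]

/-- The lift of each of the three strands is unchanged: for the top and the middle strand trivially, for
the bottom strand because the colors of the middle strand on the two sides of the top strand have
conjugate lifts. -/
lemma area_reidemeister3 (a b c : Crossing) (o₁ o₂ o₃ : ℤˣ)
    (hsign : ∃ e : ℤˣ, (o₁ : ℤ) = e * a.sign * b.sign ∧ (o₂ : ℤ) = e * a.sign * c.sign ∧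
      (o₃ : ℤ) = e * b.sign * c.sign)
    (P Q R : Pass × Pass)
    (hPQR : [P, Q, R].Perm [inOrder o₁ (⟨a, true⟩, ⟨b, true⟩),
      inOrder o₂ (⟨a, false⟩, ⟨c, true⟩), inOrder o₃ (⟨b, false⟩, ⟨c, false⟩)])
    (s : Side) (x y₁ y₁' y₂ z₁ z₁' z₂ r₁ r₁' r₂ : RotE2) (u v w t : List (Pass × RotE2))
    (h : (⟨s, x, u ++ [(P.1, y₁), (P.2, y₂)] ++ v ++ [(Q.1, z₁), (Q.2, z₂)] ++ w ++
          [(R.1, r₁), (R.2, r₂)] ++ t⟩ : ColoredDiagram RotE2).IsColoring)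
    (h' : (⟨s, x, u ++ [(P.2, y₁'), (P.1, y₂)] ++ v ++ [(Q.2, z₁'), (Q.1, z₂)] ++ w ++
          [(R.2, r₁'), (R.1, r₂)] ++ t⟩ : ColoredDiagram RotE2).IsColoring) :
    (⟨s, x, u ++ [(P.1, y₁), (P.2, y₂)] ++ v ++ [(Q.1, z₁), (Q.2, z₂)] ++ w ++
          [(R.1, r₁), (R.2, r₂)] ++ t⟩ : ColoredDiagram RotE2).area =
    (⟨s, x, u ++ [(P.2, y₁'), (P.1, y₂)] ++ v ++ [(Q.2, z₁'), (Q.1, z₂)] ++ w ++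
          [(R.2, r₁'), (R.1, r₂)] ++ t⟩ : ColoredDiagram RotE2).area := by
  set L := u ++ [(P.1, y₁), (P.2, y₂)] ++ v ++ [(Q.1, z₁), (Q.2, z₂)] ++ w ++
    [(R.1, r₁), (R.2, r₂)] ++ t with hL
  set L' := u ++ [(P.2, y₁'), (P.1, y₂)] ++ v ++ [(Q.2, z₁'), (Q.1, z₂)] ++ w ++
    [(R.2, r₁'), (R.1, r₂)] ++ t with hL'
  have hnd := h.isKnotWord.nodup
  simp only at hnd
  have hover := isOverColor_overColor hnd
  have hover' := isOverColor_overColor h'.isKnotWord.nodup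
  simp only at hover'
  have hrule := h.rule
  simp only at hrule
  nth_rw 2 [hL] at hrule
  simp only [followsColoringRule_append] at hrule
  obtain ⟨⟨⟨⟨⟨⟨-, hP⟩, -⟩, hQ⟩, -⟩, hR⟩, -⟩ := hrule
  have hrule' := h'.rule
  simp only at hrule'
  nth_rw 2 [hL'] at hrule'
  simp only [followsColoringRule_append] at hrule'
  obtain ⟨⟨⟨⟨⟨⟨-, hP'⟩, -⟩, hQ'⟩, -⟩, hR'⟩, -⟩ := hrule'
  have hlast : ∀ (x : RotE2) (p q : Pass) (y z : RotE2), lastColor x [(p, y), (q, z)] = z :=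
    fun _ _ _ _ _ => rfl
  simp only [lastColor_append, hlast] at hP hQ hR hP' hQ' hR'
  -- a statement about all strands of the triangle does not depend on their order along the knot
  have hdata : ∀ S ∈ [P, Q, R], ∃ e f f' g, (S.1, f) ∈ L ∧ (S.2, g) ∈ L ∧
      (S.2, f') ∈ L' ∧ (S.1, g) ∈ L' ∧ FollowsColoringRule L e [(S.1, f), (S.2, g)] ∧
      FollowsColoringRule L' e [(S.2, f'), (S.1, g)] := by
    simp only [List.mem_cons, List.not_mem_nil, or_false, forall_eq_or_imp, forall_eq]
    exact ⟨⟨_, y₁, y₁', y₂, by simp [hL], by simp [hL], by simp [hL'], by simp [hL'], hP, hP'⟩,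
      ⟨_, z₁, z₁', z₂, by simp [hL], by simp [hL], by simp [hL'], by simp [hL'], hQ, hQ'⟩,
      ⟨_, r₁, r₁', r₂, by simp [hL], by simp [hL], by simp [hL'], by simp [hL'], hR, hR'⟩⟩
  rw [forall_mem_iff_of_perm hPQR] at hdata
  simp only [List.mem_cons, List.not_mem_nil, or_false, forall_eq_or_imp, forall_eq] at hdata
  obtain ⟨htop, hmid, -⟩ := hdata
  -- the top strand has one color, the same in both diagrams
  have hT : overColor L a = overColor L' a ∧ overColor L b = overColor L a ∧
      overColor L' b = overColor L a := by
    rcases inOrder_cases o₁ (⟨a, true⟩, ⟨b, true⟩) with ⟨-, ho⟩ | ⟨-, ho⟩ <;> rw [ho] at htop <;>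
      obtain ⟨e, f, f', g, h1, h2, h3, h4, ⟨h5, h6, -⟩, ⟨h7, h8, -⟩⟩ := htop
    · rw [hover a f h1, hover b g h2, hover' b f' h3, hover' a g h4, h6, h7, h5]
      simp
    · rw [hover b f h1, hover a g h2, hover' a f' h3, hover' b g h4, h6, h7, h5]
      simp
  obtain ⟨ha, hb, hb'⟩ := hT
  set T := overColor L a with hTdef
  -- the color of the middle strand above `c` changes by the rotation of the top strand
  have hM : liftAct (overColor L c) * liftAct T ^ (o₂ * a.sign : ℤ) =
      liftAct T ^ (o₂ * a.sign : ℤ) * liftAct (overColor L' c) := by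
    rcases inOrder_cases o₂ (⟨a, false⟩, ⟨c, true⟩) with ⟨ho₂, ho⟩ | ⟨ho₂, ho⟩ <;>
      rw [ho] at hmid <;> obtain ⟨e, f, f', g, h1, h2, h3, h4, hr, hr'⟩ := hmid
    · obtain ⟨⟨y, hy, hz⟩, h6, -⟩ := hr
      obtain ⟨h7, -⟩ := hr'
      rw [← hover a y hy] at hz
      rw [hover c g h2, hover' c f' h3, h6, h7, ho₂]
      simpa using liftAct_mul_of_rule a hz
    · obtain ⟨h6, ⟨y, hy, hz⟩, -⟩ := hr
      obtain ⟨_, h7, -⟩ := hr'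
      rw [← hover a y hy, h6] at hz
      rw [hover c f h1, hover' c g h4, h6, ho₂]
      have := liftAct_mul_of_rule a hz
      simp only [Units.val_neg, Units.val_one, neg_mul, one_mul, zpow_neg]
      rw [eq_inv_mul_iff_mul_eq, ← mul_assoc, ← this, mul_assoc, mul_inv_cancel, mul_one]
  -- the only consequence of the condition on orders and signs that is needed
  have ho₂₃ : (o₂ : ℤ) * a.sign = o₃ * b.sign := by
    obtain ⟨e, -, h2, h3⟩ := hsign
    rw [h2, h3]
    rcases a.sign_eq with ⟨-, h⟩ | ⟨-, h⟩ <;> rcases b.sign_eq with ⟨-, h'⟩ | ⟨-, h'⟩ <;>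
      rw [h, h'] <;> ring
  have hM' : SemiconjBy (liftAct T ^ (o₃ * b.sign : ℤ)) (liftAct (overColor L' c) ^ c.sign)
      (liftAct (overColor L c) ^ c.sign) := by
    refine SemiconjBy.zpow_right ?_ _
    rw [← ho₂₃]
    exact hM.symm
  have hblock : ∀ S ∈ [P, Q, R], wordLift (overColor L) [S.1, S.2] =
      wordLift (overColor L') [S.2, S.1] := by
    refine (forall_mem_iff_of_perm hPQR).2 ?_
    simp only [List.mem_cons, List.not_mem_nil, or_false, forall_eq_or_imp, forall_eq]
    refine ⟨?_, ?_, ?_⟩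
    · rcases inOrder_cases o₁ (⟨a, true⟩, ⟨b, true⟩) with ⟨-, ho⟩ | ⟨-, ho⟩ <;>
        simp [ho, wordLift]
    · rcases inOrder_cases o₂ (⟨a, false⟩, ⟨c, true⟩) with ⟨-, ho⟩ | ⟨-, ho⟩ <;>
        simp [ho, wordLift, ← ha, ← hTdef]
    · rcases inOrder_cases o₃ (⟨b, false⟩, ⟨c, false⟩) with ⟨ho₃, ho⟩ | ⟨ho₃, ho⟩ <;>
        rw [ho] <;> rw [ho₃] at hM' <;> simp [wordLift, hb, hb'] at hM' ⊢
      · exact hM'.eq.symm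
      · exact hM'.eq
  -- the crossings of the triangle have no passages outside it
  have hmem : ∀ e : Crossing, (⟨e, false⟩ : Pass) ∈ passWord (u ++ v ++ w ++ t) →
      overColor L e = overColor L' e := by
    intro e he
    -- the letter `(e, false)` occurs only once, so `e` is none of `a`, `b`, `c`
    have hout : ∀ S ∈ [P, Q, R], S.1 ≠ ⟨e, false⟩ ∧ S.2 ≠ ⟨e, false⟩ := by
      have hperm : (passWord L).Perm
          ([P.1, P.2, Q.1, Q.2, R.1, R.2] ++ passWord (u ++ v ++ w ++ t)) := by
        rw [List.perm_iff_count]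
        intro S
        simp only [hL, passWord, List.map_append, List.map_cons, List.map_nil, List.count_append,
          List.count_cons, List.count_nil]
        omega
      have hdisj := List.disjoint_of_nodup_append (hperm.nodup_iff.1 hnd)
      have hne : ∀ S ∈ [P.1, P.2, Q.1, Q.2, R.1, R.2], S ≠ ⟨e, false⟩ := fun S hS hSe =>
        hdisj hS (hSe ▸ he)
      simp only [List.mem_cons, List.not_mem_nil, or_false, forall_eq_or_imp, forall_eq] at hne ⊢
      tauto
    have hout' : ∀ S ∈ [P, Q, R], S.1 ≠ ⟨e, true⟩ ∧ S.2 ≠ ⟨e, true⟩ := by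
      rw [forall_mem_iff_of_perm hPQR] at hout ⊢
      simp only [List.mem_cons, List.not_mem_nil, or_false, forall_eq_or_imp, forall_eq] at hout ⊢
      obtain ⟨-, h1, h2⟩ := hout
      refine ⟨?_, ?_, ?_⟩
      · rcases inOrder_cases o₁ (⟨a, true⟩, ⟨b, true⟩) with ⟨-, ho⟩ | ⟨-, ho⟩ <;>
          rcases inOrder_cases o₂ (⟨a, false⟩, ⟨c, true⟩) with ⟨-, ho₂⟩ | ⟨-, ho₂⟩ <;>
            rcases inOrder_cases o₃ (⟨b, false⟩, ⟨c, false⟩) with ⟨-, ho₃⟩ | ⟨-, ho₃⟩ <;>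
              simp [ho, ho₂, ho₃] at h1 h2 ⊢ <;> tauto
      · rcases inOrder_cases o₂ (⟨a, false⟩, ⟨c, true⟩) with ⟨-, ho₂⟩ | ⟨-, ho₂⟩ <;>
          rcases inOrder_cases o₃ (⟨b, false⟩, ⟨c, false⟩) with ⟨-, ho₃⟩ | ⟨-, ho₃⟩ <;>
            simp [ho₂, ho₃] at h2 ⊢ <;> tauto
      · rcases inOrder_cases o₃ (⟨b, false⟩, ⟨c, false⟩) with ⟨-, ho₃⟩ | ⟨-, ho₃⟩ <;>
          simp [ho₃]
    have hover_mem : (⟨e, true⟩ : Pass) ∈ passWord L := by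
      refine (h.isKnotWord.over_iff_under e).2 ?_
      simp only [passWord, hL, List.map_append, List.mem_append] at he ⊢
      tauto
    have hm := overColor_mem hover_mem
    refine (hover' e _ ?_).symm
    simp only [List.mem_cons, List.not_mem_nil, or_false, forall_eq_or_imp, forall_eq] at hout'
    obtain ⟨⟨hP1, hP2⟩, ⟨hQ1, hQ2⟩, hR1, hR2⟩ := hout'
    generalize overColor L e = y at hm ⊢
    simp only [hL, hL', List.mem_append, List.mem_cons, List.not_mem_nil, or_false, Prod.mk.injEq,
      hP1.symm, hP2.symm, hQ1.symm, hQ2.symm, hR1.symm, hR2.symm, false_and] at hm ⊢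
    exact hm
  refine area_eq_of_wordLift h h' rfl ?_
  have hsub : ∀ r : List (Pass × RotE2), (∀ p ∈ passWord r, p ∈ passWord (u ++ v ++ w ++ t)) →
      wordLift (overColor L) (passWord r) = wordLift (overColor L') (passWord r) := fun r hr =>
    wordLift_congr fun e he => hmem e (hr _ he)
  have hu := hsub u (by simp +contextual [passWord])
  have hv := hsub v (by simp +contextual [passWord])
  have hw := hsub w (by simp +contextual [passWord])
  have ht := hsub t (by simp +contextual [passWord])
  have hword : passWord L = passWord u ++ [P.1, P.2] ++ passWord v ++ [Q.1, Q.2] ++ passWord w ++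
      [R.1, R.2] ++ passWord t := by simp [hL, passWord]
  have hword' : passWord L' = passWord u ++ [P.2, P.1] ++ passWord v ++ [Q.2, Q.1] ++ passWord w ++
      [R.2, R.1] ++ passWord t := by simp [hL', passWord]
  simp only
  rw [hword, hword']
  simp only [wordLift_append]
  rw [hblock P (by simp), hblock Q (by simp), hblock R (by simp), hu, hv, hw, ht]

theorem area_eq_of_rStep {D D' : ColoredDiagram RotE2} (h : RStep D D') : D.area = D'.area := by
  obtain ⟨h, h', hm⟩ := h
  cases hm with
  | rename f _ _ s x L => exact area_rename f s x L h h'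
  | rebase s s' x u v _ => exact area_rebase s s' x u v h h'
  | reidemeister1 c o s x y z u v => exact area_reidemeister1 c o s x y z u v h h'
  | reidemeister2 c d hs o P Q hPQ s x y₁ y₂ z₁ z₂ u v w =>
    exact area_reidemeister2 c d hs o P Q hPQ s x y₁ y₂ z₁ z₂ u v w h h'
  | reidemeister3 a b c o₁ o₂ o₃ hs P Q R hPQR s x y₁ y₁' y₂ z₁ z₁' z₂ r₁ r₁' r₂ u v w t =>
    exact area_reidemeister3 a b c o₁ o₂ o₃ hs P Q R hPQR s x y₁ y₁' y₂ z₁ z₁' z₂ r₁ r₁' r₂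
      u v w t h h'

theorem area_eq_of_rEquivalent {D D' : ColoredDiagram RotE2} (h : REquivalent D D') :
    D.area = D'.area := by
  induction h with
  | rel _ _ h => exact area_eq_of_rStep h
  | refl => rfl
  | symm _ _ _ ih => exact ih.symm
  | trans _ _ _ _ _ ih₁ ih₂ => exact ih₁.trans ih₂

/-! ### The area of a coloring of the standard torus knot diagram -/

/-- A list of steps leads from `x` to `y`, each step `i` going from `before i` to `after i`. It serves to
reverse colored paths, as needed for the diagrams with `p * q < 0`. -/
def Connects {ι X : Type*} (before after : ι → X) : X → List ι → X → Prop
  | x, [], y => x = y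
  | x, i :: t, y => before i = x ∧ Connects before after (after i) t y

section Connects

variable {ι X : Type*} {before after : ι → X}

lemma Connects.append {x y z : X} {s t : List ι} (hs : Connects before after x s y)
    (ht : Connects before after y t z) : Connects before after x (s ++ t) z := by
  induction s generalizing x with
  | nil => exact Eq.mpr (by rw [show x = y from hs]; rfl) ht
  | cons i s ih => exact ⟨hs.1, ih hs.2⟩

lemma Connects.reverse {x y : X} {t : List ι} (h : Connects before after x t y) :
    Connects after before y t.reverse x := by
  induction t generalizing x with
  | nil => exact Eq.symm h
  | cons i t ih =>
    rw [List.reverse_cons]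
    exact (ih h.2).append ⟨rfl, h.1⟩

lemma connects_flatMap_range (f : ℕ → List ι) (c : ℕ → X) (N : ℕ)
    (h : ∀ t < N, Connects before after (c t) (f t) (c (t + 1))) :
    Connects before after (c 0) ((List.range N).flatMap f) (c N) := by
  induction N with
  | zero => rfl
  | succ N ih =>
    rw [List.range_succ, List.flatMap_append, List.flatMap_singleton]
    exact (ih fun t ht => h t (by omega)).append (h N (by omega))

lemma connects_map_range (g : ℕ → ι) (c : ℕ → X) (N : ℕ)
    (h : ∀ t < N, before (g t) = c t ∧ after (g t) = c (t + 1)) :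
    Connects before after (c 0) ((List.range N).map g) (c N) := by
  rw [List.map_eq_flatMap]
  exact connects_flatMap_range _ c N fun t ht => ⟨(h t ht).1, (h t ht).2⟩

end Connects

lemma pathArea_map {ι : Type*} (col : Crossing → RotE2) (pass : ι → Pass)
    {before after : ι → RotE2} {x y : RotE2} {t : List ι} (h : Connects before after x t y) :
    pathArea col x (t.map fun i => (pass i, after i)) =
      (t.map fun i => if (pass i).isOver then 0 else
        areaForm (col (pass i).crossing).center ((after i).center - (before i).center)).sum := by
  induction t generalizing x with
  | nil => rfl
  | cons i t ih =>
    obtain ⟨rfl, h⟩ := h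
    rw [List.map_cons, pathArea, ih h, List.map_cons, List.sum_cons]

/-- For `n` prime to `m`, the map `t ↦ t * m + s` permutes the residues modulo `n`. -/
lemma image_mul_add_mod {m n : ℕ} (h : m.Coprime n) (hn : 0 < n) (s : ℕ) :
    (Finset.range n).image (fun t => (t * m + s) % n) = Finset.range n ∧
      Set.InjOn (fun t => (t * m + s) % n) (Finset.range n : Set ℕ) := by
  have hinj : Set.InjOn (fun t => (t * m + s) % n) (Finset.range n : Set ℕ) := by
    intro a ha b hb hab
    simp only [Finset.coe_range, Set.mem_Iio] at ha hb
    have h1 : a * m + s ≡ b * m + s [MOD n] := hab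
    have h2 := (h1.add_right_cancel' s).cancel_right_of_coprime h.symm
    exact h2.eq_of_lt_of_lt ha hb
  refine ⟨Finset.eq_of_subset_of_card_le ?_ ?_, hinj⟩
  · intro i hi
    obtain ⟨t, -, rfl⟩ := Finset.mem_image.1 hi
    exact Finset.mem_range.2 (Nat.mod_lt _ hn)
  · rw [Finset.card_image_of_injOn hinj]

lemma sum_mul_add_mod {m n : ℕ} (h : m.Coprime n) (hn : 0 < n) (s : ℕ) (g : ℕ → ℝ) :
    ∑ t ∈ Finset.range n, g ((t * m + s) % n) = ∑ i ∈ Finset.range n, g i := by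
  obtain ⟨h1, h2⟩ := image_mul_add_mod h hn s
  conv_rhs => rw [← h1]
  rw [Finset.sum_image h2]

lemma torusPasses_eq (m n : ℕ) : torusPasses m n = (List.range n).flatMap fun t =>
    ((List.range (m - 1)).map fun j => ((t * m % n, 1 + j), true)) ++
    ((List.range (m - 1)).map fun r => (((t * m + (1 + r)) % n, m - (1 + r)), false)) := by
  simp only [torusPasses, List.range'_eq_map_range, List.map_map, Function.comp_def]

lemma over_mem_torusPasses {m n : ℕ} (h : m.Coprime n) (hn : 0 < n) {x : ℕ × ℕ}
    (hx : (x, false) ∈ torusPasses m n) : (x, true) ∈ torusPasses m n := by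
  rw [torusPasses_eq] at hx ⊢
  simp only [List.mem_flatMap, List.mem_range, List.mem_append, List.mem_map, Prod.mk.injEq,
    Bool.true_eq_false, and_false, exists_false, false_or, Bool.false_eq_true, or_false,
    and_true] at hx ⊢
  obtain ⟨t, ht, r, hr, rfl⟩ := hx
  have hmem : (t * m + (1 + r)) % n ∈ Finset.range n := Finset.mem_range.2 (Nat.mod_lt _ hn)
  rw [← (image_mul_add_mod h hn 0).1] at hmem
  obtain ⟨t', ht', he⟩ := Finset.mem_image.1 hmem
  exact ⟨t', Finset.mem_range.1 ht', m - (1 + r) - 1, by omega, Prod.ext he (by simp only; omega)⟩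

lemma sum_map_torusPasses {m n : ℕ} (h : m.Coprime n) (hn : 0 < n) (f : ℕ → ℕ → ℝ) :
    ((torusPasses m n).map fun a => if a.2 then 0 else f a.1.1 a.1.2).sum =
      ∑ i ∈ Finset.range n, ∑ j ∈ Finset.range (m - 1), f i (j + 1) := by
  have hsum (N : ℕ) (g : ℕ → ℝ) : ((List.range N).map g).sum = ∑ i ∈ Finset.range N, g i := rfl
  rw [torusPasses_eq, List.map_flatMap, List.flatMap, List.sum_flatten, List.map_map, hsum]
  simp only [Function.comp_def, List.map_append, List.map_map, List.sum_append, hsum, if_true,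
    Bool.false_eq_true, if_false, Finset.sum_const_zero, zero_add]
  rw [Finset.sum_comm, Finset.sum_comm (s := Finset.range n) (t := Finset.range (m - 1)),
    ← Finset.sum_range_reflect]
  refine Finset.sum_congr rfl fun j hj => ?_
  rw [Finset.mem_range] at hj
  rw [show m - (1 + (m - 1 - 1 - j)) = j + 1 by omega]
  exact sum_mul_add_mod h hn _ fun i => f i (j + 1)

/-- The colors of the edges fit together along the standard diagram, which is run through once. The
assumptions say that `col` is periodic and that `a (i + 1) (m - 1)` is the arc `a i 0`. -/
lemma connects_torusPasses {X : Type*} {m n : ℕ} (hm : 0 < m) (col : ℕ → ℕ → X)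
    (hmod : ∀ i j, col (i % n) j = col i j) (hturn : ∀ i, col (i + 1) (m - 1) = col i 0) :
    Connects (fun a : (ℕ × ℕ) × Bool => if a.2 then col a.1.1 0 else col a.1.1 a.1.2)
      (fun a => if a.2 then col a.1.1 0 else col ((a.1.1 + 1) % n) (a.1.2 - 1))
      (col 0 0) (torusPasses m n) (col 0 0) := by
  rw [torusPasses_eq]
  have key := connects_flatMap_range
    (before := fun a : (ℕ × ℕ) × Bool => if a.2 then col a.1.1 0 else col a.1.1 a.1.2)
    (after := fun a => if a.2 then col a.1.1 0 else col ((a.1.1 + 1) % n) (a.1.2 - 1))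
    (fun t =>
      ((List.range (m - 1)).map fun j => ((t * m % n, 1 + j), true)) ++
      ((List.range (m - 1)).map fun r => (((t * m + (1 + r)) % n, m - (1 + r)), false)))
    (fun t => col (t * m) 0) n fun t _ => ?_
  · simp only [zero_mul] at key
    rwa [← hmod (n * m) 0, Nat.mul_mod_right] at key
  · refine Connects.append (y := col (t * m) 0) ?_ ?_
    · exact connects_map_range _ (fun _ => col (t * m) 0) _ fun r _ => by simp [hmod]
    · have key := connects_map_range
        (before := fun a : (ℕ × ℕ) × Bool => if a.2 then col a.1.1 0 else col a.1.1 a.1.2)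
        (after := fun a => if a.2 then col a.1.1 0 else col ((a.1.1 + 1) % n) (a.1.2 - 1))
        (fun r => (((t * m + (1 + r)) % n, m - (1 + r)), false))
        (fun r => col (t * m + 1 + r) (m - 1 - r)) (m - 1) fun r _ => ?_
      · simp only [add_zero, Nat.sub_zero, Nat.sub_self] at key
        rwa [hturn, add_assoc, Nat.add_sub_cancel' hm, ← Nat.succ_mul] at key
      · simp only [Bool.false_eq_true, if_false, hmod]
        rw [← hmod (_ % n + 1), Nat.mod_add_mod, hmod, Nat.sub_sub]
        constructor <;> congr 1 <;> omega

lemma area_torusColored {p q : ℤ} (hp : 0 < p.natAbs) (hq : 0 < q.natAbs)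
    (hpq : p.natAbs.Coprime q.natAbs) (col : ℕ → ℕ → RotE2)
    (hmod : ∀ i j, col (i % q.natAbs) j = col i j)
    (hturn : ∀ i, col (i + 1) (p.natAbs - 1) = col i 0) :
    (torusColored p q col).area = (if 0 < p * q then 1 else -1) *
      ∑ i ∈ Finset.range q.natAbs, ∑ j ∈ Finset.range (p.natAbs - 1),
        areaForm (col i 0).center ((col (i + 1) j).center - (col i (j + 1)).center) := by
  have hcon := connects_torusPasses hp col hmod hturn
  have hsum := sum_map_torusPasses hpq hq fun i j =>
    areaForm (col i 0).center ((col (i + 1) (j - 1)).center - (col i j).center)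
  simp only [Nat.add_sub_cancel] at hsum
  rw [← hsum]
  have hover (b : Bool) (l : List ((ℕ × ℕ) × Bool)) (hl : l.Perm (torusPasses p.natAbs q.natAbs))
      (after : (ℕ × ℕ) × Bool → RotE2) (hafter : ∀ x, after (x, true) = col x.1 0) :
      ∀ c : Crossing,
        (⟨c, false⟩ : Pass) ∈ passWord (l.map fun a => ((⟨⟨a.1, b⟩, a.2⟩ : Pass), after a)) →
        overColor (l.map fun a => ((⟨⟨a.1, b⟩, a.2⟩ : Pass), after a)) c = col c.name.1 0 := by
    intro c hc
    have h1 : (⟨c, true⟩ : Pass) ∈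
        passWord (l.map fun a => ((⟨⟨a.1, b⟩, a.2⟩ : Pass), after a)) := by
      simp only [passWord, List.map_map, List.mem_map, Function.comp_apply] at hc ⊢
      obtain ⟨⟨x, o⟩, hx, he⟩ := hc
      obtain ⟨rfl, rfl⟩ := Pass.mk.injEq .. ▸ he
      exact ⟨(x, true), hl.mem_iff.2 (over_mem_torusPasses hpq hq (hl.mem_iff.1 hx)), rfl⟩
    obtain ⟨⟨x, o⟩, hx, he⟩ := List.mem_map.1 (overColor_mem h1)
    rw [Prod.mk.injEq, Pass.mk.injEq] at he
    obtain ⟨⟨rfl, rfl⟩, he⟩ := he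
    rw [← he, hafter]
  unfold torusColored ColoredDiagram.area
  split_ifs with hs
  · simp only
    rw [pathArea_congr (hover true _ (List.Perm.refl _) _ fun x => by simp),
      pathArea_map (fun c => col c.name.1 0) _ hcon, one_mul]
    refine congrArg List.sum (List.map_congr_left fun a _ => ?_)
    split_ifs <;> simp [hmod]
  · simp only
    rw [pathArea_congr (hover false _ (List.reverse_perm _) _ fun x => by simp),
      pathArea_map (fun c => col c.name.1 0) _ hcon.reverse, List.map_reverse, List.sum_reverse,
      ← List.sum_map_mul_left]
    refine congrArg List.sum (List.map_congr_left fun a _ => ?_)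
    split_ifs
    · simp
    · simp only [hmod, areaForm, sub_re, sub_im]
      ring

/-! ### The area of the coloring derived from a trochoid -/

lemma areaForm_eq (z w : ℂ) : areaForm z w = (starRingEnd ℂ z * w).im := by
  simp [areaForm]
  ring

lemma areaForm_add_left (a b w : ℂ) : areaForm (a + b) w = areaForm a w + areaForm b w := by
  simp [areaForm]
  ring

lemma areaForm_sum_right {ι : Type*} (z : ℂ) (s : Finset ι) (f : ι → ℂ) :
    areaForm z (∑ i ∈ s, f i) = ∑ i ∈ s, areaForm z (f i) := by
  simp [areaForm_eq, Finset.mul_sum]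

lemma areaForm_mul_mul (a z w : ℂ) : areaForm (a * z) (a * w) = ‖a‖ ^ 2 * areaForm z w := by
  rw [← normSq_eq_norm_sq, normSq_apply]
  simp [areaForm]
  ring

/-- The area of the coloring derived from an `(m, k; n, l)`-trochoid, up to sign and the factor
`m * n * |ρ|²`, in terms of the roots of unity `ξ = exp (2πik/m)` and `ζ = exp (2πil/n)`. -/
noncomputable def trochoidConst (ξ ζ : ℂ) : ℝ := areaForm ζ ((ξ - ζ) / (ξ - 1) * (ζ - 1))

lemma trochoidConst_ne_zero {ξ ζ : ℂ} (hξ : ‖ξ‖ = 1) (hζ : ‖ζ‖ = 1) (hξ1 : ξ ≠ 1) (hζ1 : ζ ≠ 1)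
    (hne : ξ ≠ ζ) : trochoidConst ξ ζ ≠ 0 := by
  have hξ0 : ξ ≠ 0 := by rintro rfl; simp at hξ
  have hζ0 : ζ ≠ 0 := by rintro rfl; simp at hζ
  have h1 : ξ - 1 ≠ 0 := sub_ne_zero.2 hξ1
  have h2 : 1 - ξ ≠ 0 := sub_ne_zero.2 hξ1.symm
  set E := ζ⁻¹ * ((ξ - ζ) / (ξ - 1) * (ζ - 1)) with hE
  -- `E` is purely imaginary, since complex conjugation inverts `ξ` and `ζ`
  have hconj : starRingEnd ℂ E = -E := by
    simp only [hE, map_mul, map_div₀, map_sub, map_one, map_inv₀, ← inv_eq_conj hξ,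
      ← inv_eq_conj hζ]
    have h3 : ξ⁻¹ - 1 ≠ 0 := by
      rw [sub_ne_zero]
      simpa using hξ1
    field_simp
    ring
  have hE0 : E ≠ 0 := mul_ne_zero (inv_ne_zero hζ0)
    (mul_ne_zero (div_ne_zero (sub_ne_zero.2 hne) h1) (sub_ne_zero.2 hζ1))
  have hre : E.re = 0 := by
    have := congrArg re hconj
    simp only [conj_re, neg_re] at this
    linarith
  rw [trochoidConst, areaForm_eq, ← inv_eq_conj hζ, ← hE]
  exact fun him => hE0 (Complex.ext hre him)

/-- The root of unity `exp (2πik/m)`, the ratio of successive sides of a regular polygon of type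
`(m, k)`. -/
noncomputable def stepRoot (m k : ℕ) : ℂ := Complex.exp (2 * Real.pi * I / m) ^ k

lemma stepRoot_pow_self {m : ℕ} (hm : 0 < m) (k : ℕ) : stepRoot m k ^ m = 1 := by
  rw [stepRoot, pow_right_comm, (isPrimitiveRoot_exp m hm.ne').pow_eq_one, one_pow]

lemma norm_stepRoot {m : ℕ} (hm : 0 < m) (k : ℕ) : ‖stepRoot m k‖ = 1 :=
  norm_eq_one_of_pow_eq_one (stepRoot_pow_self hm k) hm.ne'

lemma stepRoot_ne_one {m k : ℕ} (hk : 0 < k) (hkm : k < m) : stepRoot m k ≠ 1 :=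
  (isPrimitiveRoot_exp m (by omega)).pow_ne_one_of_pos_of_lt hk.ne' hkm

lemma stepRoot_ne_stepRoot {m n k l : ℕ} (h : m.Coprime n) (hk : 0 < k) (hkm : k < m)
    (hn : 0 < n) : stepRoot m k ≠ stepRoot n l := by
  intro he
  have h1 := pow_gcd_eq_one.2 ⟨stepRoot_pow_self (by omega : 0 < m) k,
    (he ▸ stepRoot_pow_self hn l : stepRoot m k ^ n = 1)⟩
  rw [h, pow_one] at h1
  exact stepRoot_ne_one hk hkm h1

lemma IsRegularPolygon.exists_eq {m k : ℕ} {v : ℕ → ℂ} (h : IsRegularPolygon m k v) :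
    ∃ c ρ : ℂ, ∀ i, v i = c + ρ * stepRoot m k ^ i := by
  obtain ⟨c, ρ, -, hv⟩ := h
  refine ⟨c, ρ, fun i => ?_⟩
  rw [hv i, stepRoot, ← pow_mul, ← Complex.exp_nat_mul]
  congr 3
  push_cast
  ring

lemma exp_trochoidAngle {m k n l : ℕ} (hm : 0 < m) (hn : 0 < n) :
    Complex.exp (trochoidAngle m k n l * I) = stepRoot n l * (stepRoot m k)⁻¹ := by
  have hm' : (m : ℂ) ≠ 0 := by exact_mod_cast hm.ne'
  have hn' : (n : ℂ) ≠ 0 := by exact_mod_cast hn.ne'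
  rw [stepRoot, stepRoot, ← Complex.exp_nat_mul, ← Complex.exp_nat_mul, ← Complex.exp_neg,
    ← Complex.exp_add]
  congr 1
  simp only [trochoidAngle]
  push_cast
  field_simp
  ring

/-- The polygon `P i` is obtained from `P 0` by turning it by `ζ ^ i` about the center `c` of `Q` and
shifting the labels by `i`. -/
lemma trochoidVertex_eq {m k n l : ℕ} (hm : 0 < m) (hn : 0 < n) {v w : ℕ → ℂ} {c ρ γ σ : ℂ}
    (hv : ∀ i, v i = c + ρ * stepRoot n l ^ i) (hw : ∀ i, w i = c + γ + σ * stepRoot m k ^ i)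
    (h : γ + σ * stepRoot m k = ρ * stepRoot n l) (h₀ : γ + σ = ρ) (i j : ℕ) :
    trochoidVertex m k n l v w i j =
      c + stepRoot n l ^ i * (γ + σ * (stepRoot m k ^ j * ((stepRoot m k)⁻¹) ^ i)) := by
  have hξ : stepRoot m k ≠ 0 := norm_ne_zero_iff.1 (by rw [norm_stepRoot hm]; exact one_ne_zero)
  induction i with
  | zero => simp [trochoidVertex, hw]; ring
  | succ i ih =>
    rw [trochoidVertex, ih, hv, exp_trochoidAngle hm hn]
    generalize stepRoot m k = ξ at *
    generalize stepRoot n l = ζ at *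
    have h1 : ξ * ξ⁻¹ = 1 := mul_inv_cancel₀ hξ
    simp only [pow_succ]
    linear_combination ζ ^ i * ζ * ξ⁻¹ * h - ζ ^ i * ζ * σ * h1 - ζ ^ i * ζ * h₀

/-- The number `r` is the circumradius of `Q`. -/
lemma exists_area_trochoidColored {p q : ℤ} (hp : 0 < p.natAbs) (hq : 0 < q.natAbs)
    (hpq : p.natAbs.Coprime q.natAbs) {k l : ℕ} (hk : 0 < k) (hk' : k < p.natAbs)
    (hl : 0 < l) (hl' : l < q.natAbs) {v w : ℕ → ℂ} (h : IsTrochoid p.natAbs k q.natAbs l v w) :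
    ∃ r : ℝ, 0 ≤ r ∧ sideLength v = r * ‖1 - stepRoot q.natAbs l‖ ∧
      (trochoidColored p q k l v w).area = (if 0 < p * q then 1 else -1) *
        (p.natAbs * q.natAbs * trochoidConst (stepRoot p.natAbs k) (stepRoot q.natAbs l)) *
          r ^ 2 := by
  obtain ⟨c, ρ, hv⟩ := h.polygon_center.exists_eq
  obtain ⟨c', σ, hw⟩ := h.polygon_start.exists_eq
  have h₀ := h.vertex_zero
  have h₁ := h.vertex_one
  have hξm := stepRoot_pow_self hp k
  have hζn := stepRoot_pow_self hq l
  have hξ1 := stepRoot_ne_one hk hk'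
  have hζ1 := stepRoot_ne_one hl hl'
  have hζnorm := norm_stepRoot hq l
  have hξ0 : stepRoot p.natAbs k ≠ 0 :=
    norm_ne_zero_iff.1 (by rw [norm_stepRoot hp]; exact one_ne_zero)
  rw [hv, hw] at h₀ h₁
  simp only [pow_zero, mul_one, pow_one] at h₀ h₁
  obtain ⟨γ, rfl⟩ : ∃ γ, c' = c + γ := ⟨c' - c, by ring⟩
  have h₀' : γ + σ = ρ := by linear_combination h₀
  have h₁' : γ + σ * stepRoot p.natAbs k = ρ * stepRoot q.natAbs l := by linear_combination h₁
  have hvert := trochoidVertex_eq hp hq hv hw h₁' h₀'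
  refine ⟨‖ρ‖, norm_nonneg _, ?_, ?_⟩
  · rw [sideLength, hv, hv, dist_eq_norm, ← norm_mul]
    congr 1
    ring
  have hcol : ∀ i j, trochoidVertex p.natAbs k q.natAbs l v w i (i + j + 1) =
      c + stepRoot q.natAbs l ^ i * (γ + σ * stepRoot p.natAbs k ^ (j + 1)) := by
    intro i j
    rw [hvert, add_assoc i j 1, add_comm i, pow_add _ (j + 1) i, mul_assoc (_ ^ (j + 1)),
      ← mul_pow, mul_inv_cancel₀ hξ0, one_pow, mul_one]
  have hcol₀ : ∀ i, trochoidVertex p.natAbs k q.natAbs l v w i (i + 0 + 1) =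
      c + stepRoot q.natAbs l ^ i * (ρ * stepRoot q.natAbs l) := by
    intro i
    refine (hcol i 0).trans ?_
    rw [zero_add, pow_one, h₁']
  rw [trochoidColored, area_torusColored hp hq hpq]
  · simp only [hcol, hcol₀]
    rw [mul_assoc]
    congr 1
    generalize stepRoot p.natAbs k = ξ at *
    generalize stepRoot q.natAbs l = ζ at *
    generalize p.natAbs = m at *
    generalize q.natAbs = n at *
    have hgeom : ∑ j ∈ Finset.range (m - 1), ξ ^ (j + 1) = -1 := by
      have h1 := mul_geom_sum ξ m
      rw [hξm, sub_self] at h1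
      have h2 := (mul_eq_zero.1 h1).resolve_left (sub_ne_zero.2 hξ1)
      obtain ⟨m, rfl⟩ : ∃ m', m = m' + 1 := ⟨m - 1, by omega⟩
      rw [Finset.sum_range_succ'] at h2
      simp only [pow_zero] at h2
      simpa using eq_neg_of_add_eq_zero_left h2
    -- the first summand of the center `c + ρ ζ ^ (i + 1)` above does not contribute to the area
    have hgeomζ : ∑ i ∈ Finset.range n, ζ ^ i * (ζ - 1) = 0 := by
      rw [← Finset.sum_mul, geom_sum_mul, hζn, sub_self]
    have hγ : γ * (ζ - 1) = σ * (ξ - ζ) := by linear_combination ζ * h₀' - h₁'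
    have hγρ : γ = ρ * ((ξ - ζ) / (ξ - 1)) := by
      have : ξ - 1 ≠ 0 := sub_ne_zero.2 hξ1
      field_simp
      linear_combination ξ * h₀' - h₁'
    -- the sum of the displacements under the arc `a i 0`
    have hinner (i : ℕ) : ∑ j ∈ Finset.range (m - 1),
        (c + ζ ^ (i + 1) * (γ + σ * ξ ^ (j + 1)) - (c + ζ ^ i * (γ + σ * ξ ^ (j + 1 + 1)))) =
          (m : ℂ) * γ * (ζ ^ i * (ζ - 1)) := by
      have : ∀ j, c + ζ ^ (i + 1) * (γ + σ * ξ ^ (j + 1)) -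
          (c + ζ ^ i * (γ + σ * ξ ^ (j + 1 + 1))) =
            ζ ^ i * (γ * (ζ - 1)) + ζ ^ i * (σ * (ζ - ξ)) * ξ ^ (j + 1) := fun j => by ring
      simp only [this]
      rw [Finset.sum_add_distrib, ← Finset.mul_sum (f := fun j => ξ ^ (j + 1)), hgeom, Finset.sum_const, Finset.card_range,
        nsmul_eq_mul, Nat.cast_sub hp]
      push_cast
      linear_combination -ζ ^ i * hγ
    simp only [← areaForm_sum_right, hinner]
    simp only [areaForm_add_left]
    rw [Finset.sum_add_distrib, ← areaForm_sum_right, ← Finset.mul_sum, hgeomζ]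
    have hterm (i : ℕ) : areaForm (ζ ^ i * (ρ * ζ)) ((m : ℂ) * γ * (ζ ^ i * (ζ - 1))) =
        m * trochoidConst ξ ζ * ‖ρ‖ ^ 2 := by
      have h1 : (m : ℂ) * γ * (ζ ^ i * (ζ - 1)) =
          ζ ^ i * (ρ * ((m : ℂ) * ((ξ - ζ) / (ξ - 1) * (ζ - 1)))) := by rw [hγρ]; ring
      rw [h1, areaForm_mul_mul, areaForm_mul_mul, norm_pow, hζnorm, trochoidConst]
      simp only [areaForm, mul_re, mul_im, natCast_re, natCast_im]
      ring
    simp only [hterm, Finset.sum_const, Finset.card_range, nsmul_eq_mul]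
    simp only [areaForm, mul_zero, zero_re, zero_im]
    ring
  · intro i j
    simp only [hcol]
    rw [← pow_eq_pow_mod i hζn]
  · intro i
    simp only [hcol, hcol₀, Nat.sub_add_cancel hp, hξm, pow_succ]
    congr 2
    linear_combination stepRoot q.natAbs l ^ i * stepRoot q.natAbs l * h₀'

theorem theorem5p2 (p q : ℤ) (hp : 2 ≤ |p|) (hq : 2 ≤ |q|) (hpq : IsCoprime p q)
    (k l : ℕ) (hk : 1 ≤ k) (hk' : k ≤ p.natAbs - 1) (hl : 1 ≤ l) (hl' : l ≤ q.natAbs - 1)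
    (v w v' w' : ℕ → ℂ)
    (h : IsTrochoid p.natAbs k q.natAbs l v w)
    (h' : IsTrochoid p.natAbs k q.natAbs l v' w')
    (hR : REquivalent (trochoidColored p q k l v w) (trochoidColored p q k l v' w')) :
    sideLength v = sideLength v' := by
  have hkp : k < p.natAbs := by omega
  have hlq : l < q.natAbs := by omega
  have hp0 : 0 < p.natAbs := by omega
  have hq0 : 0 < q.natAbs := by omega
  have hcop : p.natAbs.Coprime q.natAbs := Int.isCoprime_iff_gcd_eq_one.1 hpq
  obtain ⟨r, hr, hside, harea⟩ := exists_area_trochoidColored hp0 hq0 hcop hk hkp hl hlq h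
  obtain ⟨r', hr', hside', harea'⟩ := exists_area_trochoidColored hp0 hq0 hcop hk hkp hl hlq h'
  have hA := area_eq_of_rEquivalent hR
  rw [harea, harea'] at hA
  have hconst : trochoidConst (stepRoot p.natAbs k) (stepRoot q.natAbs l) ≠ 0 :=
    trochoidConst_ne_zero (norm_stepRoot hp0 k) (norm_stepRoot hq0 l) (stepRoot_ne_one hk hkp)
      (stepRoot_ne_one hl hlq) (stepRoot_ne_stepRoot hcop hk hkp hq0)
  have hrr : r ^ 2 = r' ^ 2 := by
    refine mul_left_cancel₀ (mul_ne_zero ?_ ?_) hA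
    · split_ifs <;> norm_num
    · have hp1 : (p.natAbs : ℝ) ≠ 0 := by exact_mod_cast hp0.ne'
      have hq1 : (q.natAbs : ℝ) ≠ 0 := by exact_mod_cast hq0.ne'
      exact mul_ne_zero (mul_ne_zero hp1 hq1) hconst
  rw [hside, hside', (pow_left_inj₀ hr hr' two_ne_zero).1 hrr]
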